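/- Let $n\ge 1$, let $\Omega\subseteq\mathbb C^n$ be a domain (a non-empty connected open set), and let $\mathcal F$ be a family of holomorphic functions $\Omega\to\mathbb C$ without zeros in $\Omega$. For $f\in\mathcal F$ and a non-empty open set $D$ with $\overline D\subset\Omega$ put $$m(f,D)=\begin{cases}\displaystyle\sup_{z,w\in D}\frac{\ln|f(z)|}{\ln|f(w)|}, & \text{if } |f(w)|\neq 1 \text{ for all } w\in D,\\[2mm] +\infty, & \text{if } |f(w)|=1 \text{ for some } w\in D,\end{cases}$$ $$m'(f,D)=\sup_{z,w\in D}\frac{|f(z)|}{|f(w)|},\qquad L(f,D)=\min\{m(f,D),\,m'(f,D)\},$$ with values in the extended reals. Call $\mathcal F$ normal in $\Omega$ if every sequence in $\mathcal F$ has a subsequence that either converges uniformly on each compact subset of $\Omega$ to a complex-valued limit function, or converges uniformly to $\infty$ on each compact subset of $\Omega$. Then $\mathcal F$ is normal in $\Omega$ if and only if for each point $z_0\in\Omega$ there are $r_0>0$ and a real constant $C$ such that the Euclidean ball $B(z_0,r_0)$ satisfies $\overline{B(z_0,r_0)}\subset\Omega$ and $L(f,B(z_0,r_0))\le C$ for all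 $f\in\mathcal F$. -/

import Mathlib

namespace Mandelbrojt

open Filter

/-- A family `F` of functions is normal in `Ω ⊆ ℂⁿ`: every sequence in `F` has a subsequence that
either converges uniformly on every compact subset of `Ω` to a (finite, complex valued) limit
function, or converges uniformly to `∞` on every compact subset of `Ω`. -/
def IsNormalFamily {n : ℕ} (F : Set (EuclideanSpace ℂ (Fin n) → ℂ))
    (Ω : Set (EuclideanSpace ℂ (Fin n))) : Prop :=
  ∀ u : ℕ → EuclideanSpace ℂ (Fin n) → ℂ, (∀ k, u k ∈ F) →
    ∃ φ : ℕ → ℕ, StrictMono φ ∧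
      ((∃ g : EuclideanSpace ℂ (Fin n) → ℂ, ∀ K ⊆ Ω, IsCompact K →
          TendstoUniformlyOn (fun k => u (φ k)) g atTop K) ∨
        (∀ K ⊆ Ω, IsCompact K → ∀ M : ℝ, ∀ᶠ k in atTop, ∀ z ∈ K, M < ‖u (φ k) z‖))

open Classical in
/-- `m(f, D)`: the supremum over `z, w ∈ D` of `ln |f z| / ln |f w|` if `|f| ≠ 1` everywhere on
`D`, and `∞` if `|f w| = 1` for some `w ∈ D`. -/
noncomputable def logRatioSup {n : ℕ} (f : EuclideanSpace ℂ (Fin n) → ℂ)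
    (D : Set (EuclideanSpace ℂ (Fin n))) : EReal :=
  if ∀ w ∈ D, ‖f w‖ ≠ 1 then
    ⨆ z ∈ D, ⨆ w ∈ D, ((Real.log ‖f z‖ / Real.log ‖f w‖ : ℝ) : EReal)
  else ⊤

/-- `m'(f, D)`: the supremum over `z, w ∈ D` of `|f z| / |f w|`. -/
noncomputable def ratioSup {n : ℕ} (f : EuclideanSpace ℂ (Fin n) → ℂ)
    (D : Set (EuclideanSpace ℂ (Fin n))) : EReal :=
  ⨆ z ∈ D, ⨆ w ∈ D, ((‖f z‖ / ‖f w‖ : ℝ) : EReal)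

/-- `L(f, D) = min (m(f, D), m'(f, D))`. -/
noncomputable def minRatio {n : ℕ} (f : EuclideanSpace ℂ (Fin n) → ℂ)
    (D : Set (EuclideanSpace ℂ (Fin n))) : EReal :=
  min (logRatioSup f D) (ratioSup f D)

end Mandelbrojt

/-!
For zero-free `f`, the Harnack inequality applies to the positive pluriharmonic functions `log |f|`
(where `1 < |f|`) and `log M - log |f|` (where `|f| ≤ M`). On a normal family these two situations
exhaust all `f` near a given point, with a common `M`, and each of them bounds `L(f, B)`.

Conversely, a bound on `L(f, B)` turns a bound on `|f|` at one point of `B` into a bound on all of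
`B` that does not depend on `f`. Such bounds propagate along the connected set `Ω`, so a sequence
either is bounded at one point along a subsequence, hence locally bounded and subject to Montel's
theorem, or tends to `∞` locally uniformly.
-/

namespace Mandelbrojt

open Filter InnerProductSpace Metric Set
open scoped Topology

section Harnack

theorem harnack {u : ℂ → ℝ} {c w : ℂ} {R : ℝ} (hu : HarmonicContOnCl u (ball c R))
    (hu₀ : ∀ z ∈ sphere c R, 0 ≤ u z) (hw : w ∈ ball c R) :
    u w ≤ (R + ‖w - c‖) / (R - ‖w - c‖) * u c := by
  have hR : |R| = R := abs_of_pos (pos_of_mem_ball hw)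
  have hu_cont : ContinuousOn u (sphere c |R|) :=
    hR.symm ▸ hu.continuousOn_ball.mono sphere_subset_closedBall
  calc u w = Real.circleAverage ((Complex.re ∘ herglotzRieszKernel c w) • u) c R :=
        (hu.circleAverage_re_herglotzRieszKernel_smul hw).symm
    _ ≤ Real.circleAverage (((R + ‖w - c‖) / (R - ‖w - c‖)) • u) c R := by
        refine Real.circleAverage_mono (ContinuousOn.circleIntegrable' ?_)
          (hu_cont.const_smul _).circleIntegrable' fun z hz => ?_
        · exact (Complex.continuous_re.comp_continuousOn
            (continuousOn_herglotzRieszKernel_sphere hw)).smul hu_cont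
        · rw [hR] at hz
          exact mul_le_mul_of_nonneg_right (re_herglotzRieszKernel_le hz hw) (hu₀ z hz)
    _ = (R + ‖w - c‖) / (R - ‖w - c‖) * u c := by
        rw [Real.circleAverage_smul,
          InnerProductSpace.HarmonicContOnCl.circleAverage_eq (hR.symm ▸ hu),
          smul_eq_mul]

variable {E : Type*} [NormedAddCommGroup E] [NormedSpace ℂ E] {f : E → ℂ} {c z w : E} {r : ℝ}

theorem log_norm_le_three_mul_log_norm_center (hf : DifferentiableOn ℂ f (ball c (2 * r)))
    (hf₁ : ∀ x ∈ ball c (2 * r), 1 ≤ ‖f x‖) (hz : z ∈ ball c r) :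
    Real.log ‖f z‖ ≤ 3 * Real.log ‖f c‖ := by
  let line : ℂ → E := fun t => c + t • (z - c)
  have hline : MapsTo line (closedBall 0 2) (ball c (2 * r)) := fun t ht => by
    rw [mem_closedBall_zero_iff] at ht
    rw [mem_ball_iff_norm] at hz
    calc dist (line t) c = ‖t‖ * ‖z - c‖ := by
          rw [dist_eq_norm, add_sub_cancel_left, norm_smul]
      _ ≤ 2 * ‖z - c‖ := by gcongr
      _ < 2 * r := by gcongr
  have hopen : IsOpen (line ⁻¹' ball c (2 * r)) := isOpen_ball.preimage (by fun_prop)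
  have han : AnalyticOnNhd ℂ (f ∘ line) (line ⁻¹' ball c (2 * r)) :=
    (hf.comp (by fun_prop) (mapsTo_preimage _ _)).analyticOnNhd hopen
  have hharm : ∀ t ∈ closedBall (0 : ℂ) 2, HarmonicAt (fun t => Real.log ‖f (line t)‖) t :=
    fun t ht => (han t (hline ht)).harmonicAt_log_norm <|
      norm_pos_iff.1 (zero_lt_one.trans_le (hf₁ _ (hline ht)))
  have h_harnack := harnack (c := 0) (w := 1) (R := 2) (u := fun t => Real.log ‖f (line t)‖)
    (HarmonicOnNhd.harmonicContOnCl fun t ht => hharm t (closure_ball_subset_closedBall ht))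
    (fun t ht => Real.log_nonneg (hf₁ _ (hline (sphere_subset_closedBall ht)))) (by simp)
  convert h_harnack using 2 <;> norm_num [line]

theorem log_norm_le_three_mul_log_norm (hf : DifferentiableOn ℂ f (ball c (5 * r)))
    (hf₁ : ∀ x ∈ ball c (5 * r), 1 ≤ ‖f x‖) (hz : z ∈ ball c r) (hw : w ∈ ball c r) :
    Real.log ‖f z‖ ≤ 3 * Real.log ‖f w‖ := by
  have hsub : ball w (2 * (2 * r)) ⊆ ball c (5 * r) :=
    ball_subset_ball' (by linarith [mem_ball.1 hw])
  exact log_norm_le_three_mul_log_norm_center (hf.mono hsub) (fun x hx => hf₁ x (hsub hx)) <|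
    mem_ball.2 (by linarith [dist_triangle_right z w c, mem_ball.1 hz, mem_ball.1 hw])

theorem log_sub_log_norm_le_three_mul {M : ℝ} (hf : DifferentiableOn ℂ f (ball c (5 * r)))
    (hf₀ : ∀ x ∈ ball c (5 * r), f x ≠ 0) (hfM : ∀ x ∈ ball c (5 * r), ‖f x‖ ≤ M)
    (hz : z ∈ ball c r) (hw : w ∈ ball c r) :
    Real.log M - Real.log ‖f z‖ ≤ 3 * (Real.log M - Real.log ‖f w‖) := by
  have hsub : ball c r ⊆ ball c (5 * r) :=
    ball_subset_ball (by linarith [pos_of_mem_ball hz])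
  have hpos : ∀ x ∈ ball c (5 * r), 0 < ‖f x‖ := fun x hx => norm_pos_iff.2 (hf₀ x hx)
  have hM : 0 < M := (hpos z (hsub hz)).trans_le (hfM z (hsub hz))
  have hnorm : ∀ x, ‖(M : ℂ) / f x‖ = M / ‖f x‖ := fun x => by
    rw [norm_div, Complex.norm_of_nonneg hM.le]
  have hlog : ∀ x ∈ ball c r, Real.log ‖(M : ℂ) / f x‖ = Real.log M - Real.log ‖f x‖ :=
    fun x hx => by rw [hnorm, Real.log_div hM.ne' (hpos x (hsub hx)).ne']
  rw [← hlog z hz, ← hlog w hw]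
  have hdiff : DifferentiableOn ℂ (fun x => (M : ℂ) / f x) (ball c (5 * r)) := by
    simpa only [div_eq_mul_inv] using (hf.fun_inv hf₀).const_mul (M : ℂ)
  exact log_norm_le_three_mul_log_norm (f := fun x => (M : ℂ) / f x) hdiff
    (fun x hx => by rw [hnorm]; exact (one_le_div (hpos x hx)).2 (hfM x hx)) hz hw

end Harnack

section Montel

theorem exists_subseq_tendsto_of_equicontinuous {X Y : Type*} [TopologicalSpace X]
    [LocallyCompactSpace X] [SigmaCompactSpace X] [MetricSpace Y] [ProperSpace Y] {v : ℕ → C(X, Y)}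
    (hv : Equicontinuous fun k => ⇑(v k))
    (hb : ∀ x, Bornology.IsBounded (range fun k => v k x)) :
    ∃ g : C(X, Y), ∃ φ : ℕ → ℕ, StrictMono φ ∧ Tendsto (v ∘ φ) atTop (𝓝 g) := by
  have hT2 : T2Space (UniformOnFun X Y {K | IsCompact K}) := UniformOnFun.t2Space_of_covering <|
    eq_univ_of_forall fun x => mem_sUnion_of_mem (mem_singleton x) isCompact_singleton
  have hcompact : IsCompact (closure (range v)) := by
    refine ArzelaAscoli.isCompact_closure_of_isClosedEmbedding
      (F := fun f : C(X, Y) => (f : X → Y)) (𝔖 := {K | IsCompact K}) (fun _ hK => hK)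
      ContinuousMap.isUniformEmbedding_toUniformOnFunIsCompact.isClosedEmbedding
      (fun K _ => Equicontinuous.equicontinuousOn ?_ K) fun K _ x _ =>
        ⟨_, (hb x).isCompact_closure, ?_⟩
    · intro x U hU
      filter_upwards [hv x U hU] with y hy
      rintro ⟨_, k, rfl⟩
      exact hy k
    · rintro _ ⟨k, rfl⟩
      exact subset_closure (mem_range_self k)
  obtain ⟨g, -, φ, hφ, hg⟩ := hcompact.tendsto_subseq fun k => subset_closure (mem_range_self k)
  exact ⟨g, φ, hφ, hg⟩

variable {E F : Type*} [NormedAddCommGroup E] [NormedSpace ℂ E]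
  [NormedAddCommGroup F] [NormedSpace ℂ F]

theorem equicontinuousAt_of_norm_le {ι : Type*} {v : ι → E → F} {c : E} {r M : ℝ} (hr : 0 < r)
    (hv : ∀ i, DifferentiableOn ℂ (v i) (ball c r)) (hM : ∀ i, ∀ z ∈ ball c r, ‖v i z‖ ≤ M) :
    EquicontinuousAt v c := by
  refine equicontinuousAt_of_continuity_modulus (fun z => 2 * M / r * dist z c) ?_ _ ?_
  · have : Continuous fun z => 2 * M / r * dist z c := by fun_prop
    simpa using this.tendsto c
  · filter_upwards [ball_mem_nhds c hr] with z hz i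
    rw [dist_comm]
    refine Complex.dist_le_div_mul_dist_of_mapsTo_ball (hv i) (fun w hw => ?_) hz
    rw [mem_closedBall_iff_norm]
    linarith [norm_sub_le (v i w) (v i c), hM i w hw, hM i c (mem_ball_self hr)]

theorem montel [ProperSpace E] [ProperSpace F] {Ω : Set E} (hΩ : IsOpen Ω)
    {v : ℕ → E → F} (hv : ∀ k, DifferentiableOn ℂ (v k) Ω)
    (hb : ∀ K ⊆ Ω, IsCompact K → ∃ M : ℝ, ∀ k, ∀ z ∈ K, ‖v k z‖ ≤ M) :
    ∃ g : E → F, ∃ φ : ℕ → ℕ, StrictMono φ ∧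
      TendstoLocallyUniformlyOn (v ∘ φ) g atTop Ω := by
  have : LocallyCompactSpace Ω := hΩ.locallyCompactSpace
  let V : ℕ → C(Ω, F) := fun k => ⟨Ω.domRestrict (v k), (hv k).continuousOn.domRestrict⟩
  have hequi : Equicontinuous fun k => ⇑(V k) := by
    rintro ⟨c, hc⟩
    obtain ⟨r, hr, hrΩ⟩ := nhds_basis_closedBall.mem_iff.1 (hΩ.mem_nhds hc)
    obtain ⟨M, hM⟩ := hb _ hrΩ (isCompact_closedBall c r)
    have : EquicontinuousAt v c := equicontinuousAt_of_norm_le hr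
      (fun k => (hv k).mono (ball_subset_closedBall.trans hrΩ))
      fun k z hz => hM k z (ball_subset_closedBall hz)
    exact fun U hU => (continuous_subtype_val.tendsto ⟨c, hc⟩).eventually (this U hU)
  obtain ⟨G, φ, hφ, hG⟩ := exists_subseq_tendsto_of_equicontinuous hequi fun z => by
    obtain ⟨M, hM⟩ := hb {z.1} (singleton_subset_iff.2 z.2) isCompact_singleton
    exact isBounded_iff_forall_norm_le.2 ⟨M, forall_mem_range.2 fun k => hM k z rfl⟩
  refine ⟨Function.extend (↑) G 0, φ, hφ, ?_⟩
  rw [tendstoLocallyUniformlyOn_iff_tendstoLocallyUniformly_comp_coe,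
    Function.extend_comp Subtype.val_injective]
  exact ContinuousMap.tendsto_iff_tendstoLocallyUniformly.1 hG

end Montel

section Propagation

variable {X Y : Type*} [Norm Y] {F : Set (X → Y)} {s t : Set X}

/-- Bounds on the members of `F` propagate from `s` to `t`: a bound on `‖f‖` at a single point of
`s` gives a bound on all of `t`, the same for all `f ∈ F`. This is the form in which the bound on
`L(f, D)` is used. -/
def BoundsPropagate (F : Set (X → Y)) (s t : Set X) : Prop :=
  ∀ M : ℝ, ∃ M' : ℝ, ∀ f ∈ F, ∀ x ∈ s, ∀ y ∈ t, ‖f x‖ ≤ M → ‖f y‖ ≤ M'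

namespace BoundsPropagate

theorem mono {s' t' : Set X} (h : BoundsPropagate F s t) (hs : s' ⊆ s) (ht : t' ⊆ t) :
    BoundsPropagate F s' t' := fun M =>
  (h M).imp fun _ hM' f hf x hx y hy => hM' f hf x (hs hx) y (ht hy)

theorem trans {x : X} (h₁ : BoundsPropagate F s {x}) (h₂ : BoundsPropagate F {x} t) :
    BoundsPropagate F s t := fun M => by
  obtain ⟨M₁, hM₁⟩ := h₁ M
  obtain ⟨M₂, hM₂⟩ := h₂ M₁
  exact ⟨M₂, fun f hf y hy z hz hfy => hM₂ f hf x rfl z hz (hM₁ f hf y hy x rfl hfy)⟩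

theorem union_left {s' : Set X} (h : BoundsPropagate F s t) (h' : BoundsPropagate F s' t) :
    BoundsPropagate F (s ∪ s') t := fun M => by
  obtain ⟨M₁, hM₁⟩ := h M
  obtain ⟨M₂, hM₂⟩ := h' M
  refine ⟨max M₁ M₂, fun f hf x hx y hy hfx => ?_⟩
  rcases hx with hx | hx
  · exact le_max_of_le_left (hM₁ f hf x hx y hy hfx)
  · exact le_max_of_le_right (hM₂ f hf x hx y hy hfx)

theorem union_right {t' : Set X} (h : BoundsPropagate F s t) (h' : BoundsPropagate F s t') :
    BoundsPropagate F s (t ∪ t') := fun M => by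
  obtain ⟨M₁, hM₁⟩ := h M
  obtain ⟨M₂, hM₂⟩ := h' M
  refine ⟨max M₁ M₂, fun f hf x hx y hy hfx => ?_⟩
  rcases hy with hy | hy
  · exact le_max_of_le_left (hM₁ f hf x hx y hy hfx)
  · exact le_max_of_le_right (hM₂ f hf x hx y hy hfx)

variable [TopologicalSpace X] {Ω K : Set X} {a b : X}

theorem of_isPreconnected (hΩ : IsPreconnected Ω)
    (h : ∀ x ∈ Ω, ∃ U ∈ 𝓝[Ω] x, BoundsPropagate F U U) (ha : a ∈ Ω) (hb : b ∈ Ω) :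
    BoundsPropagate F {a} {b} := by
  refine hΩ.induction₂' (fun x y => BoundsPropagate F {x} {y}) (fun x hx => ?_)
    (fun _ _ _ _ _ _ => trans) ha hb
  obtain ⟨U, hU, hprop⟩ := h x hx
  have hxU : {x} ⊆ U := singleton_subset_iff.2 (mem_of_mem_nhdsWithin hx hU)
  filter_upwards [hU] with y hy
  exact ⟨hprop.mono hxU (singleton_subset_iff.2 hy), hprop.mono (singleton_subset_iff.2 hy) hxU⟩

theorem to_isCompact (hΩ : IsPreconnected Ω)
    (h : ∀ x ∈ Ω, ∃ U ∈ 𝓝[Ω] x, BoundsPropagate F U U) (ha : a ∈ Ω) (hKΩ : K ⊆ Ω)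
    (hK : IsCompact K) : BoundsPropagate F {a} K := by
  refine hK.induction_on (fun M => ⟨M, by simp⟩) (fun s t hst ht => ht.mono le_rfl hst)
    (fun s t => union_right) fun x hx => ?_
  obtain ⟨U, hU, hprop⟩ := h x (hKΩ hx)
  have hxU : {x} ⊆ U := singleton_subset_iff.2 (mem_of_mem_nhdsWithin (hKΩ hx) hU)
  exact ⟨U, nhdsWithin_mono x hKΩ hU,
    (of_isPreconnected hΩ h ha (hKΩ hx)).trans (hprop.mono hxU le_rfl)⟩

theorem from_isCompact (hΩ : IsPreconnected Ω)
    (h : ∀ x ∈ Ω, ∃ U ∈ 𝓝[Ω] x, BoundsPropagate F U U) (hKΩ : K ⊆ Ω) (hK : IsCompact K)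
    (ha : a ∈ Ω) : BoundsPropagate F K {a} := by
  refine hK.induction_on (fun M => ⟨M, by simp⟩) (fun s t hst ht => ht.mono hst le_rfl)
    (fun s t => union_left) fun x hx => ?_
  obtain ⟨U, hU, hprop⟩ := h x (hKΩ hx)
  have hxU : {x} ⊆ U := singleton_subset_iff.2 (mem_of_mem_nhdsWithin (hKΩ hx) hU)
  exact ⟨U, nhdsWithin_mono x hKΩ hU,
    (hprop.mono le_rfl hxU).trans (of_isPreconnected hΩ h (hKΩ hx) ha)⟩

end BoundsPropagate

end Propagation

section NormalFamily

variable {n : ℕ} {F : Set (EuclideanSpace ℂ (Fin n) → ℂ)} {Ω : Set (EuclideanSpace ℂ (Fin n))}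

theorem IsNormalFamily.exists_forall_lt_norm_or_forall_norm_le (hF : IsNormalFamily F Ω)
    (hF_cont : ∀ f ∈ F, ContinuousOn f Ω) {K : Set (EuclideanSpace ℂ (Fin n))} (hKΩ : K ⊆ Ω)
    (hK : IsCompact K) (m : ℝ) :
    ∃ M : ℝ, ∀ f ∈ F, (∀ z ∈ K, m < ‖f z‖) ∨ ∀ z ∈ K, ‖f z‖ ≤ M := by
  by_contra! hcon
  choose u huF hum hu using fun k : ℕ => hcon k
  obtain ⟨φ, hφ, ⟨g, hg⟩ | hinf⟩ := hF u huF
  · have hgK := hg K hKΩ hK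
    have hg_cont : ContinuousOn g K := hgK.continuousOn <|
      .of_forall fun k => (hF_cont _ (huF (φ k))).mono hKΩ
    obtain ⟨B, hB⟩ := hK.exists_bound_of_continuousOn hg_cont
    obtain ⟨k, hclose, hk⟩ := ((Metric.tendstoUniformlyOn_iff.1 hgK 1 one_pos).and
      ((tendsto_natCast_atTop_atTop.comp hφ.tendsto_atTop).eventually_ge_atTop (B + 1))).exists
    obtain ⟨z, hz, hlarge⟩ := hu (φ k)
    have hfar : B + 1 < ‖u (φ k) z‖ := hk.trans_lt hlarge
    have hnear := hclose z hz
    rw [dist_comm, dist_eq_norm] at hnear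
    linarith [norm_sub_norm_le (u (φ k) z) (g z), hB z hz]
  · obtain ⟨k, hk⟩ := (hinf K hKΩ hK m).exists
    obtain ⟨z, hz, hsmall⟩ := hum (φ k)
    exact (hk z hz).not_ge hsmall

theorem isNormalFamily_of_boundsPropagate (hΩ : IsOpen Ω) (hΩ' : IsConnected Ω)
    (hF : ∀ f ∈ F, DifferentiableOn ℂ f Ω)
    (h : ∀ z ∈ Ω, ∃ U ∈ 𝓝[Ω] z, BoundsPropagate F U U) : IsNormalFamily F Ω := by
  intro u hu
  obtain ⟨a, ha⟩ := hΩ'.nonempty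
  by_cases hbdd : ∃ m : ℝ, ∃ᶠ k in atTop, ‖u k a‖ ≤ m
  · obtain ⟨m, hm⟩ := hbdd
    obtain ⟨φ, hφ, hφm⟩ := extraction_of_frequently_atTop hm
    obtain ⟨g, ψ, hψ, hg⟩ := montel hΩ (v := u ∘ φ) (fun k => hF _ (hu _)) fun K hKΩ hK => by
      obtain ⟨M, hM⟩ := BoundsPropagate.to_isCompact hΩ'.isPreconnected h ha hKΩ hK m
      exact ⟨M, fun k z hz => hM _ (hu _) a rfl z hz (hφm k)⟩
    exact ⟨φ ∘ ψ, hφ.comp hψ, .inl ⟨g, (tendstoLocallyUniformlyOn_iff_forall_isCompact hΩ).1 hg⟩⟩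
  · push Not at hbdd
    refine ⟨id, strictMono_id, .inr fun K hKΩ hK M => ?_⟩
    obtain ⟨M', hM'⟩ := BoundsPropagate.from_isCompact hΩ'.isPreconnected h hKΩ hK ha M
    filter_upwards [hbdd M'] with k hk z hz
    by_contra! hle
    exact hk.not_ge (hM' _ (hu k) z hz a rfl hle)

end NormalFamily

section RatioBounds

variable {X E : Type*} [NormedAddCommGroup E] {f : X → E} {D : Set X} {z w : X} {C M : ℝ}

theorem norm_le_of_log_ratio_le [TopologicalSpace X] (hD : IsPreconnected D) (hf : ContinuousOn f D)
    (hf₁ : ∀ x ∈ D, ‖f x‖ ≠ 1) (hC : ∀ z ∈ D, ∀ w ∈ D, Real.log ‖f z‖ / Real.log ‖f w‖ ≤ C)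
    (hz : z ∈ D) (hw : w ∈ D) (hfw : ‖f w‖ ≤ M) :
    ‖f z‖ ≤ max 1 (M ^ C) := by
  rcases le_or_gt ‖f z‖ 1 with hz₁ | hz₁
  · exact le_max_of_le_left hz₁
  have hw₁ : 1 < ‖f w‖ := by
    by_contra! hw₁
    obtain ⟨x, hx, hx₁⟩ := hD.intermediate_value hw hz hf.norm ⟨hw₁, hz₁.le⟩
    exact hf₁ x hx hx₁
  have hC₀ : 0 ≤ C :=
    (div_pos (Real.log_pos hz₁) (Real.log_pos hw₁)).le.trans (hC z hz w hw)
  refine le_max_of_le_right ((Real.le_rpow_iff_log_le (by linarith) (by linarith)).2 ?_)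
  calc Real.log ‖f z‖ ≤ C * Real.log ‖f w‖ := (div_le_iff₀ (Real.log_pos hw₁)).1 (hC z hz w hw)
    _ ≤ C * Real.log M := by gcongr

theorem norm_le_of_ratio_le (hf₀ : ∀ x ∈ D, f x ≠ 0)
    (hC : ∀ z ∈ D, ∀ w ∈ D, ‖f z‖ / ‖f w‖ ≤ C) (hz : z ∈ D) (hw : w ∈ D) (hfw : ‖f w‖ ≤ M) :
    ‖f z‖ ≤ C * M := by
  have hC₀ : 0 ≤ C := (by positivity : 0 ≤ ‖f z‖ / ‖f w‖).trans (hC z hz w hw)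
  calc ‖f z‖ ≤ C * ‖f w‖ := (div_le_iff₀ (norm_pos_iff.2 (hf₀ w hw))).1 (hC z hz w hw)
    _ ≤ C * M := by gcongr

end RatioBounds

section MinRatio

variable {n : ℕ} {f : EuclideanSpace ℂ (Fin n) → ℂ} {D : Set (EuclideanSpace ℂ (Fin n))}
  {c : EuclideanSpace ℂ (Fin n)} {r C M : ℝ}

theorem logRatioSup_le_iff : logRatioSup f D ≤ C ↔
    (∀ w ∈ D, ‖f w‖ ≠ 1) ∧ ∀ z ∈ D, ∀ w ∈ D, Real.log ‖f z‖ / Real.log ‖f w‖ ≤ C := by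
  unfold logRatioSup
  split_ifs with h
  · simp only [iSup_le_iff, EReal.coe_le_coe_iff, and_iff_right h]
  · simp [h]

theorem ratioSup_le_iff : ratioSup f D ≤ C ↔ ∀ z ∈ D, ∀ w ∈ D, ‖f z‖ / ‖f w‖ ≤ C := by
  simp only [ratioSup, iSup_le_iff, EReal.coe_le_coe_iff]

theorem minRatio_le_iff : minRatio f D ≤ C ↔
    ((∀ w ∈ D, ‖f w‖ ≠ 1) ∧ ∀ z ∈ D, ∀ w ∈ D, Real.log ‖f z‖ / Real.log ‖f w‖ ≤ C) ∨
      ∀ z ∈ D, ∀ w ∈ D, ‖f z‖ / ‖f w‖ ≤ C :=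
  min_le_iff.trans (or_congr logRatioSup_le_iff ratioSup_le_iff)

theorem minRatio_ball_le_of_one_lt_norm (hf : DifferentiableOn ℂ f (ball c (5 * r)))
    (hf₁ : ∀ x ∈ ball c (5 * r), 1 < ‖f x‖) : minRatio f (ball c r) ≤ (3 : ℝ) := by
  have hlt : ∀ w ∈ ball c r, 1 < ‖f w‖ := fun w hw =>
    hf₁ w (ball_subset_ball (by linarith [pos_of_mem_ball hw]) hw)
  refine minRatio_le_iff.2 (.inl ⟨fun w hw => (hlt w hw).ne', fun z hz w hw => ?_⟩)
  rw [div_le_iff₀ (Real.log_pos (hlt w hw))]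
  exact log_norm_le_three_mul_log_norm hf (fun x hx => (hf₁ x hx).le) hz hw

theorem minRatio_ball_le_of_norm_le (hf : DifferentiableOn ℂ f (ball c (5 * r)))
    (hf₀ : ∀ x ∈ ball c (5 * r), f x ≠ 0) (hM : 1 < M)
    (hfM : ∀ x ∈ ball c (5 * r), ‖f x‖ ≤ M) :
    minRatio f (ball c r) ≤ (max 5 (M ^ 6) : ℝ) := by
  have hsub : ∀ x ∈ ball c r, x ∈ ball c (5 * r) := fun x hx =>
    ball_subset_ball (by linarith [pos_of_mem_ball hx]) hx
  have hpos : ∀ x ∈ ball c r, 0 < ‖f x‖ := fun x hx => norm_pos_iff.2 (hf₀ x (hsub x hx))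
  have hlogM : 0 < Real.log M := Real.log_pos hM
  have hharnack : ∀ z ∈ ball c r, ∀ w ∈ ball c r,
      Real.log M - Real.log ‖f z‖ ≤ 3 * (Real.log M - Real.log ‖f w‖) := fun z hz w hw =>
    log_sub_log_norm_le_three_mul hf hf₀ hfM hz hw
  rw [minRatio_le_iff]
  by_cases hsmall : ∀ w ∈ ball c r, Real.log ‖f w‖ ≤ -Real.log M
  · have hneg : ∀ w ∈ ball c r, Real.log ‖f w‖ < 0 := fun w hw => by linarith [hsmall w hw]
    refine .inl ⟨fun w hw h => ?_, fun z hz w hw => le_max_of_le_left ?_⟩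
    · simpa [h] using hneg w hw
    · rw [div_le_iff_of_neg (hneg w hw)]
      linarith [hharnack z hz w hw, hsmall w hw]
  · push Not at hsmall
    obtain ⟨w₀, hw₀, hlog⟩ := hsmall
    refine .inr fun z hz w hw => le_max_of_le_right ?_
    have hupper : Real.log ‖f z‖ ≤ Real.log M := Real.log_le_log (hpos z hz) (hfM z (hsub z hz))
    have hlower : -5 * Real.log M ≤ Real.log ‖f w‖ := by linarith [hharnack w hw w₀ hw₀]
    rw [← Real.log_le_log_iff (div_pos (hpos z hz) (hpos w hw)) (by positivity),
      Real.log_div (hpos z hz).ne' (hpos w hw).ne', Real.log_pow]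
    push_cast
    linarith

variable {F : Set (EuclideanSpace ℂ (Fin n) → ℂ)} {Ω : Set (EuclideanSpace ℂ (Fin n))}

theorem boundsPropagate_of_minRatio_le (hD : IsPreconnected D)
    (hF_cont : ∀ f ∈ F, ContinuousOn f D) (hF₀ : ∀ f ∈ F, ∀ z ∈ D, f z ≠ 0)
    (hC : ∀ f ∈ F, minRatio f D ≤ C) : BoundsPropagate F D D := by
  refine fun M => ⟨max (max 1 (M ^ C)) (C * M), fun f hf w hw z hz hfw => ?_⟩
  rcases minRatio_le_iff.1 (hC f hf) with ⟨hf₁, hlog⟩ | hratio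
  · exact le_max_of_le_left (norm_le_of_log_ratio_le hD (hF_cont f hf) hf₁ hlog hz hw hfw)
  · exact le_max_of_le_right (norm_le_of_ratio_le (hF₀ f hf) hratio hz hw hfw)

theorem IsNormalFamily.exists_minRatio_ball_le (hF : IsNormalFamily F Ω)
    (hF_holo : ∀ f ∈ F, DifferentiableOn ℂ f Ω) (hF₀ : ∀ f ∈ F, ∀ z ∈ Ω, f z ≠ 0)
    (hΩ : closedBall c (5 * r) ⊆ Ω) : ∃ C : ℝ, ∀ f ∈ F, minRatio f (ball c r) ≤ C := by
  obtain ⟨M, hM⟩ := hF.exists_forall_lt_norm_or_forall_norm_le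
    (fun f hf => (hF_holo f hf).continuousOn) hΩ (isCompact_closedBall _ _) 1
  have hsub : ball c (5 * r) ⊆ closedBall c (5 * r) := ball_subset_closedBall
  refine ⟨max 3 (max 5 (max M 2 ^ 6)), fun f hf => ?_⟩
  have hf_holo : DifferentiableOn ℂ f (ball c (5 * r)) := (hF_holo f hf).mono (hsub.trans hΩ)
  rcases hM f hf with hlarge | hbdd
  · exact (minRatio_ball_le_of_one_lt_norm hf_holo fun x hx => hlarge x (hsub hx)).trans
      (EReal.coe_le_coe_iff.2 (le_max_left _ _))
  · exact (minRatio_ball_le_of_norm_le hf_holo (fun x hx => hF₀ f hf x (hΩ (hsub hx)))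
      (lt_max_of_lt_right one_lt_two)
      fun x hx => le_max_of_le_left (hbdd x (hsub hx))).trans
      (EReal.coe_le_coe_iff.2 (le_max_right _ _))

end MinRatio

end Mandelbrojt

theorem theorem1p1 {n : ℕ} (hn : 1 ≤ n) (Ω : Set (EuclideanSpace ℂ (Fin n)))
    (hΩ_open : IsOpen Ω) (hΩ_conn : IsConnected Ω)
    (F : Set (EuclideanSpace ℂ (Fin n) → ℂ))
    (hF_holo : ∀ f ∈ F, DifferentiableOn ℂ f Ω)
    (hF_zero_free : ∀ f ∈ F, ∀ z ∈ Ω, f z ≠ 0) :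
    Mandelbrojt.IsNormalFamily F Ω ↔
      ∀ z₀ ∈ Ω, ∃ r₀ : ℝ, 0 < r₀ ∧ closure (Metric.ball z₀ r₀) ⊆ Ω ∧
        ∃ C : ℝ, ∀ f ∈ F, Mandelbrojt.minRatio f (Metric.ball z₀ r₀) ≤ (C : EReal) := by
  constructor
  · intro hF z₀ hz₀
    obtain ⟨R, hR, hRΩ⟩ := Metric.nhds_basis_closedBall.mem_iff.1 (hΩ_open.mem_nhds hz₀)
    have hsub : closure (Metric.ball z₀ (R / 5)) ⊆ Metric.closedBall z₀ R :=
      Metric.closure_ball_subset_closedBall.trans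
        (Metric.closedBall_subset_closedBall (by linarith))
    refine ⟨R / 5, by positivity, hsub.trans hRΩ, ?_⟩
    exact hF.exists_minRatio_ball_le hF_holo hF_zero_free (by rwa [mul_div_cancel₀ R (by simp)])
  · intro hL
    refine Mandelbrojt.isNormalFamily_of_boundsPropagate hΩ_open hΩ_conn hF_holo fun z₀ hz₀ => ?_
    obtain ⟨r, hr, hrΩ, C, hC⟩ := hL z₀ hz₀
    have hsub : Metric.ball z₀ r ⊆ Ω := subset_closure.trans hrΩ
    exact ⟨_, mem_nhdsWithin_of_mem_nhds (Metric.ball_mem_nhds z₀ hr),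
      Mandelbrojt.boundsPropagate_of_minRatio_le (convex_ball z₀ r).isPreconnected
        (fun f hf => (hF_holo f hf).continuousOn.mono hsub)
        (fun f hf z hz => hF_zero_free f hf z (hsub hz)) hC⟩
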